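/- Let $a,b\in\mathbb R$, let $\gamma\ge 2$ be an integer, and let $V_{\rm sparse}:\{1,2,3,\dots\}\to\mathbb R$ be given by $V_{\rm sparse}(n)=b$ if $n=\gamma^k$ for some integer $k\ge 1$, and $V_{\rm sparse}(n)=a$ otherwise. Let $H$ be the discrete Schrödinger operator on $\ell^2(\{1,2,3,\dots\})$, $$(H\psi)(n)=\psi(n-1)+\psi(n+1)+V_{\rm sparse}(n)\psi(n),\qquad \psi(0)=0 .$$ For $T>0$ and $p>0$ put $$a(n,T)=\frac1T\int_0^\infty e^{-2t/T}\,|\langle\delta_n,e^{-itH}\delta_1\rangle|^2\,dt,\qquad \langle|X|^p_{\delta_1}\rangle(T)=\sum_{n\ge1} n^p\,a(n,T),$$ $$\beta^-_{\delta_1}(p)=\liminf_{T\to+\infty}\frac{\log\,\langle|X|^p_{\delta_1}\rangle(T)}{\log T}.$$ Let $$\nu=\frac{2\log\sqrt{2+(a-b)^2}}{\log\gamma}.$$ Then $$\beta^-_{\delta_1}(p)\ \ge\ \frac{p-1-4\nu}{1+\nu}\qquad\text{for every } p>0 .$$ Moreover, for every $p>0$, this lower bound is strictly larger than $\frac{p-5}{2}$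 if and only if $\gamma>2+(a-b)^2$. -/

import Mathlib

open Filter MeasureTheory
open scoped ENNReal

noncomputable section

/-- The Hilbert space `ℓ²(ℕ)` of the half-line, with sites `ℕ = {1, 2, 3, …}`. -/
abbrev HalfLine : Type := lp (fun _ : ℕ+ => ℂ) 2

/-- The extension of a sequence on `{1, 2, …}` to `{0, 1, 2, …}` by the Dirichlet boundary
condition `ψ(0) = 0`. -/
def dirichletExt (ψ : ℕ+ → ℂ) (n : ℕ) : ℂ :=
  if h : 0 < n then ψ (n.toPNat h) else 0

/-- The discrete Schrödinger expression on the half-line,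
`(Hψ)(n) = ψ(n-1) + ψ(n+1) + V(n) ψ(n)` for `n ≥ 1`, where `ψ(0) = 0`. -/
def schrodingerFun (V : ℕ+ → ℝ) (ψ : ℕ+ → ℂ) (n : ℕ+) : ℂ :=
  dirichletExt ψ ((n : ℕ) - 1) + dirichletExt ψ ((n : ℕ) + 1) + (V n : ℂ) * ψ n

theorem dirichletExt_coe (ψ : ℕ+ → ℂ) (n : ℕ+) : dirichletExt ψ (n : ℕ) = ψ n := by
  unfold dirichletExt
  rw [dif_pos n.pos]
  rfl

theorem dirichletExt_hasSum (ψ : HalfLine) :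
    HasSum (fun n : ℕ => ‖dirichletExt ψ n‖ ^ 2) (‖ψ‖ ^ 2) := by
  have h : HasSum (fun n : ℕ+ => ‖ψ n‖ ^ 2) (‖ψ‖ ^ 2) := by
    have := lp.hasSum_norm (p := 2) (by norm_num) ψ
    simpa using this
  rw [← Function.Injective.hasSum_iff PNat.coe_injective]
  · simpa [Function.comp_def, dirichletExt_coe] using h
  · intro n hn
    have : n = 0 := by
      by_contra h0
      exact hn ⟨⟨n, Nat.pos_of_ne_zero h0⟩, rfl⟩
    simp [this, dirichletExt]

/-- For a bounded potential the Schrödinger expression maps `ℓ²(ℕ)` boundedly to itself. -/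
theorem schrodingerFun_bound {V : ℕ+ → ℝ} {C : ℝ} (hV : ∀ n, |V n| ≤ C) (ψ : HalfLine)
    (s : Finset ℕ+) :
    ∑ n ∈ s, ‖schrodingerFun V ψ n‖ ^ 2 ≤ 3 * (2 + C ^ 2) * ‖ψ‖ ^ 2 := by
  have hC : 0 ≤ C := (abs_nonneg _).trans (hV 1)
  have hs := dirichletExt_hasSum ψ
  have key : ∀ i : ℕ+ → ℕ, Function.Injective i →
      ∑ n ∈ s, ‖dirichletExt ψ (i n)‖ ^ 2 ≤ ‖ψ‖ ^ 2 := by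
    intro i hi
    have h1 := sum_le_hasSum (s.map ⟨i, hi⟩) (fun _ _ => by positivity) hs
    simpa using h1
  have k1 := key (fun n => (n : ℕ) - 1) (by
    intro m n h
    have hm := m.pos
    have hn := n.pos
    apply PNat.eq
    simp only at h
    omega)
  have k2 := key (fun n => (n : ℕ) + 1) (by
    intro m n h
    apply PNat.eq
    simp only at h
    omega)
  have k3 := key (fun n => (n : ℕ)) PNat.coe_injective
  have hpt : ∀ n ∈ s, ‖schrodingerFun V ψ n‖ ^ 2 ≤
      3 * (‖dirichletExt ψ ((n : ℕ) - 1)‖ ^ 2 + ‖dirichletExt ψ ((n : ℕ) + 1)‖ ^ 2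
        + C ^ 2 * ‖dirichletExt ψ (n : ℕ)‖ ^ 2) := by
    intro n _
    have hle : ‖schrodingerFun V ψ n‖ ≤ ‖dirichletExt ψ ((n : ℕ) - 1)‖
        + ‖dirichletExt ψ ((n : ℕ) + 1)‖ + C * ‖dirichletExt ψ (n : ℕ)‖ := by
      rw [dirichletExt_coe]
      refine (norm_add₃_le).trans ?_
      have : ‖(V n : ℂ) * ψ n‖ ≤ C * ‖ψ n‖ := by
        rw [norm_mul, Complex.norm_real, Real.norm_eq_abs]
        exact mul_le_mul_of_nonneg_right (hV n) (norm_nonneg _)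
      gcongr
    generalize ‖dirichletExt ψ ((n : ℕ) - 1)‖ = x at *
    generalize ‖dirichletExt ψ ((n : ℕ) + 1)‖ = y at *
    generalize ‖dirichletExt ψ (n : ℕ)‖ = z at *
    have h0 := norm_nonneg (schrodingerFun V ψ n)
    have h2 := pow_le_pow_left₀ h0 hle 2
    nlinarith [sq_nonneg (x - y), sq_nonneg (x - C * z), sq_nonneg (y - C * z)]
  refine (Finset.sum_le_sum hpt).trans ?_
  rw [← Finset.mul_sum, Finset.sum_add_distrib, Finset.sum_add_distrib, ← Finset.mul_sum]
  nlinarith [mul_le_mul_of_nonneg_left k3 (sq_nonneg C)]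

theorem schrodingerFun_memlp {V : ℕ+ → ℝ} (hV : ∃ C : ℝ, ∀ n, |V n| ≤ C) (ψ : HalfLine) :
    Memℓp (schrodingerFun V ψ) 2 := by
  obtain ⟨C, hC⟩ := hV
  refine memℓp_gen' (C := 3 * (2 + C ^ 2) * ‖ψ‖ ^ 2) (fun s => ?_)
  simpa using schrodingerFun_bound hC ψ s

theorem dirichletExt_add (f g : ℕ+ → ℂ) (n : ℕ) :
    dirichletExt (f + g) n = dirichletExt f n + dirichletExt g n := by
  unfold dirichletExt
  split_ifs <;> simp

theorem dirichletExt_smul (c : ℂ) (f : ℕ+ → ℂ) (n : ℕ) :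
    dirichletExt (c • f) n = c * dirichletExt f n := by
  unfold dirichletExt
  split_ifs <;> simp

/-- The discrete half-line Schrödinger operator `H` on `ℓ²(ℕ)` with a bounded real potential `V`
and a Dirichlet boundary condition, as a bounded operator:
`(Hψ)(n) = ψ(n-1) + ψ(n+1) + V(n) ψ(n)`, `ψ(0) = 0`. -/
def schrodingerOp (V : ℕ+ → ℝ) (hV : ∃ C : ℝ, ∀ n, |V n| ≤ C) : HalfLine →L[ℂ] HalfLine :=
  LinearMap.mkContinuousOfExistsBound
    { toFun := fun ψ => ⟨schrodingerFun V ψ, schrodingerFun_memlp hV ψ⟩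
      map_add' := by
        intro f g
        ext n
        simp only [lp.coeFn_add, schrodingerFun, dirichletExt_add, Pi.add_apply]
        ring
      map_smul' := by
        intro c f
        ext n
        simp only [lp.coeFn_smul, schrodingerFun, dirichletExt_smul, Pi.smul_apply,
          RingHom.id_apply, smul_eq_mul]
        ring }
    (by
      obtain ⟨C, hC⟩ := hV
      refine ⟨Real.sqrt (3 * (2 + C ^ 2)), fun ψ => ?_⟩
      refine lp.norm_le_of_forall_sum_le (p := 2) (by norm_num) (by positivity) (fun s => ?_)
      have h := schrodingerFun_bound hC ψ s
      have e : (Real.sqrt (3 * (2 + C ^ 2)) * ‖ψ‖) ^ 2 = 3 * (2 + C ^ 2) * ‖ψ‖ ^ 2 := by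
        rw [mul_pow, Real.sq_sqrt (by positivity)]
      rw [← e] at h
      simp only [ENNReal.toReal_ofNat, Real.rpow_ofNat]
      exact h)

theorem schrodingerOp_apply (V : ℕ+ → ℝ) (hV : ∃ C : ℝ, ∀ n, |V n| ≤ C) (ψ : HalfLine)
    (n : ℕ+) : schrodingerOp V hV ψ n =
      dirichletExt ψ ((n : ℕ) - 1) + dirichletExt ψ ((n : ℕ) + 1) + (V n : ℂ) * ψ n :=
  rfl

/-- The state `δ_n` located at the site `n`. -/
def deltaState (n : ℕ+) : HalfLine := lp.single 2 n (1 : ℂ)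

/-- The time evolution `ψ(t) = exp(-itH) ψ`. -/
def evolve (H : HalfLine →L[ℂ] HalfLine) (ψ : HalfLine) (t : ℝ) : HalfLine :=
  NormedSpace.exp ((-(Complex.I * (t : ℂ))) • H) ψ

/-- The time-averaged probabilities
`a(n,T) = (1/T) ∫_0^∞ e^{-2t/T} |⟨δ_n, ψ(t)⟩|² dt`. -/
def avgProb (H : HalfLine →L[ℂ] HalfLine) (ψ : HalfLine) (n : ℕ+) (T : ℝ) : ℝ :=
  (1 / T) * ∫ t in Set.Ioi (0 : ℝ),
    Real.exp (-2 * t / T) * ‖inner ℂ (deltaState n) (evolve H ψ t)‖ ^ 2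

/-- The time-averaged moments `⟨|X|_ψ^p⟩(T) = ∑_n |n|^p a(n,T)`, a sum of nonnegative terms,
taken in `[0, ∞]`. -/
def avgMoment (H : HalfLine →L[ℂ] HalfLine) (ψ : HalfLine) (p T : ℝ) : ℝ≥0∞ :=
  ∑' n : ℕ+, ENNReal.ofReal (((n : ℕ) : ℝ) ^ p * avgProb H ψ n T)

/-- The lower growth exponent
`β⁻_ψ(p) = liminf_{T → +∞} log ⟨|X|_ψ^p⟩(T) / log T`, with values in `[-∞, ∞]`. -/
def lowerGrowthExponent (H : HalfLine →L[ℂ] HalfLine) (ψ : HalfLine) (p : ℝ) : EReal :=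
  liminf (fun T : ℝ => ENNReal.log (avgMoment H ψ p T) / ((Real.log T : ℝ) : EReal)) atTop

open Classical in
/-- The sparse potential: `b` at the sites `γ^k`, `k = 1, 2, 3, …`, and `a` at all other sites. -/
def sparsePotential (a b : ℝ) (γ : ℕ) (n : ℕ+) : ℝ :=
  if ∃ k : ℕ, 1 ≤ k ∧ (n : ℕ) = γ ^ k then b else a

theorem sparsePotential_bounded (a b : ℝ) (γ : ℕ) :
    ∃ C : ℝ, ∀ n, |sparsePotential a b γ n| ≤ C := by
  refine ⟨max |a| |b|, fun n => ?_⟩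
  unfold sparsePotential
  split_ifs
  · exact le_max_right _ _
  · exact le_max_left _ _

/-- The half-line Schrödinger operator with the sparse potential. -/
def sparseOp (a b : ℝ) (γ : ℕ) : HalfLine →L[ℂ] HalfLine :=
  schrodingerOp (sparsePotential a b γ) (sparsePotential_bounded a b γ)

/-- The exponent `ν = 2 log √(2 + (a-b)²) / log γ`. -/
def sparseNu (a b : ℝ) (γ : ℕ) : ℝ :=
  2 * Real.log (Real.sqrt (2 + (a - b) ^ 2)) / Real.log γ

end

/-! A single energy, `E = a`, suffices. With `ε = 2/T`, the Laplace transform `W` of the evolution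
at `a + iε` solves `(H - a - iε) W = -i δ₁` (`evolveLaplace_equation`), and Cauchy–Schwarz in time
gives `a(n,T) ≥ (2/T²) |W(n)|²` (`le_avgProb`).

`W` cannot decay fast. At energy `a` the transfer matrix at an ordinary site is a rotation up to
`O(ε)`, so only the barriers `γ^k` cost a factor `2 + (a-b)²`. There are `log_γ n` of them up to
`n`, for a total cost of at most `n^ν` (`sparse_solution_lower_bound`, `barrier_factor_le`), while
the `ε`-losses stay bounded for `n ≤ 2T`. Hence `a(n,T) + a(n+1,T) ≳ T⁻² n^{-ν}`, and summing over a
window `[M, 2M)` with `M ~ T^{1/(1+ν)}` bounds the moment from below. -/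

/-! ### Coordinates and self-adjointness of `H`. -/

theorem inner_deltaState (n : ℕ+) (ψ : HalfLine) : inner ℂ (deltaState n) ψ = ψ n := by
  simp [deltaState, lp.inner_single_left]

theorem norm_deltaState (n : ℕ+) : ‖deltaState n‖ = 1 := by
  simp [deltaState]

theorem dirichletExt_inner_hasSum (φ ψ : HalfLine) :
    HasSum (fun n : ℕ => dirichletExt ψ n * star (dirichletExt φ n)) (inner ℂ φ ψ) := by
  have h := lp.hasSum_inner (𝕜 := ℂ) φ ψ
  rw [← Function.Injective.hasSum_iff PNat.coe_injective]
  · simpa [Function.comp_def, dirichletExt_coe] using h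
  · intro n hn
    have : n = 0 := by
      by_contra h0
      exact hn ⟨⟨n, Nat.pos_of_ne_zero h0⟩, rfl⟩
    simp [this, dirichletExt]

theorem dirichletExt_shift_summable (φ ψ : HalfLine) :
    Summable (fun n : ℕ => dirichletExt ψ n * star (dirichletExt φ (n + 1))) := by
  have h1 := (dirichletExt_hasSum ψ).summable
  have h2 := (summable_nat_add_iff 1).2 (dirichletExt_hasSum φ).summable
  refine Summable.of_norm_bounded (h1.add h2) (fun n => ?_)
  rw [norm_mul, norm_star]
  nlinarith [sq_nonneg (‖dirichletExt ψ n‖ - ‖dirichletExt φ (n + 1)‖),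
    sq_nonneg (‖dirichletExt ψ n‖), sq_nonneg (‖dirichletExt φ (n + 1)‖)]

theorem hasSum_of_pointwise_eq {f g : ℕ → ℂ} {s : ℂ} (h : HasSum f s) (hfg : ∀ n, g n = f n) :
    HasSum g s := by
  rwa [funext hfg]

/-- Summation by parts puts the form on the bonds `(n, n+1)`, where its Hermitian symmetry can be
read off term by term. -/
theorem schrodingerOp_inner_hasSum (V : ℕ+ → ℝ) (hV : ∃ C : ℝ, ∀ n, |V n| ≤ C)
    (φ ψ : HalfLine) :
    HasSum (fun n : ℕ => dirichletExt ψ n * star (dirichletExt φ (n + 1))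
      + star (dirichletExt φ n) * dirichletExt ψ (n + 1)
      + dirichletExt (fun k => (V k : ℂ) * ψ k) (n + 1) * star (dirichletExt φ (n + 1)))
      (inner ℂ φ (schrodingerOp V hV ψ)) := by
  set χ := schrodingerOp V hV ψ with hχ
  have h := (hasSum_nat_add_iff' 1).2 (dirichletExt_inner_hasSum φ χ)
  have hz : ∀ f : ℕ+ → ℂ, dirichletExt f 0 = 0 := fun f => by simp [dirichletExt]
  have hp : ∀ (f : ℕ+ → ℂ) (n : ℕ), dirichletExt f (n + 1) = f n.succPNat := fun f n => by
    simpa using dirichletExt_coe f n.succPNat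
  have hs2 := dirichletExt_shift_summable ψ φ
  -- the coordinates of `H ψ` paired with `φ`, with one term shifted by one site
  have e : ∀ n : ℕ, dirichletExt χ (n + 1) * star (dirichletExt φ (n + 1)) =
      dirichletExt ψ n * star (dirichletExt φ (n + 1))
      + dirichletExt ψ (n + 2) * star (dirichletExt φ (n + 1))
      + dirichletExt (fun k => (V k : ℂ) * ψ k) (n + 1) * star (dirichletExt φ (n + 1)) := by
    intro n
    rw [hp χ, hχ, schrodingerOp_apply]
    simp only [Nat.succPNat_coe, Nat.succ_eq_add_one, Nat.add_sub_cancel, hp]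
    ring
  have ht : Summable (fun n : ℕ => star (dirichletExt φ n) * dirichletExt ψ (n + 1)) := by
    have := hs2.star
    simpa [mul_comm] using this
  -- A telescoping sum; its boundary term vanishes because `φ(0) = 0`.
  have h3 : HasSum (fun n : ℕ => dirichletExt ψ (n + 2) * star (dirichletExt φ (n + 1))
      - star (dirichletExt φ n) * dirichletExt ψ (n + 1)) 0 := by
    have h4 := (hasSum_nat_add_iff' 1).2 ht.hasSum
    have := h4.sub ht.hasSum
    simp only [Finset.sum_range_one, hz, star_zero, zero_mul, sub_zero, sub_self] at this
    exact hasSum_of_pointwise_eq this fun n => by ring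
  have h5 := h.sub h3
  simp only [Finset.sum_range_one, hz, star_zero, mul_zero, sub_zero] at h5
  refine hasSum_of_pointwise_eq h5 fun n => ?_
  rw [e]
  ring

theorem isSelfAdjoint_schrodingerOp (V : ℕ+ → ℝ) (hV : ∃ C : ℝ, ∀ n, |V n| ≤ C) :
    IsSelfAdjoint (schrodingerOp V hV) := by
  rw [ContinuousLinearMap.isSelfAdjoint_iff_isSymmetric]
  intro φ ψ
  have h1 := schrodingerOp_inner_hasSum V hV φ ψ
  have h2 := (schrodingerOp_inner_hasSum V hV ψ φ).star
  simp only [RCLike.star_def, inner_conj_symm] at h2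
  refine HasSum.unique h2 ?_
  change HasSum _ (inner ℂ φ (schrodingerOp V hV ψ))
  refine hasSum_of_pointwise_eq h1 fun n => ?_
  have hp : ∀ (f : ℕ+ → ℂ) (n : ℕ), dirichletExt f (n + 1) = f n.succPNat := fun f n => by
    simpa using dirichletExt_coe f n.succPNat
  simp only [hp, map_add, map_mul, Complex.conj_conj, Complex.conj_ofReal, RCLike.star_def]
  ring

/-! ### Unitary evolution and its Laplace transform. -/

theorem real_smul_smul_operator (H : HalfLine →L[ℂ] HalfLine) (s : ℝ) (c : ℂ) :
    s • (c • H) = ((s : ℂ) * c) • H := by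
  ext x n
  simp [mul_assoc]

theorem hasDerivAt_evolve (H : HalfLine →L[ℂ] HalfLine) (ψ : HalfLine) (t : ℝ) :
    HasDerivAt (evolve H ψ) (-Complex.I • H (evolve H ψ t)) t := by
  have h := hasDerivAt_exp_smul_const' (𝕂 := ℝ) ((-Complex.I) • H) t
  have e : ∀ s : ℝ, s • ((-Complex.I) • H) = (-(Complex.I * (s : ℂ))) • H := by
    intro s
    rw [real_smul_smul_operator]
    congr 1
    ring
  have h2 := ((ContinuousLinearMap.apply ℂ HalfLine ψ).restrictScalars ℝ).hasFDerivAt.comp_hasDerivAt t h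
  have he : ∀ u : ℝ, NormedSpace.exp ((-(Complex.I * (u : ℂ))) • H)
      = NormedSpace.exp (u • ((-Complex.I) • H)) := fun u =>
    congrArg NormedSpace.exp (e u).symm
  refine (h2.congr_deriv ?_).congr_of_eventuallyEq (Eventually.of_forall fun u => ?_)
  · exact congrArg (fun A : HalfLine →L[ℂ] HalfLine => -Complex.I • H (A ψ)) (he t).symm
  · exact congrArg (fun A : HalfLine →L[ℂ] HalfLine => A ψ) (he u)

theorem norm_evolve {H : HalfLine →L[ℂ] HalfLine} (hH : IsSelfAdjoint H) (ψ : HalfLine) (t : ℝ) :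
    ‖evolve H ψ t‖ = ‖ψ‖ := by
  have hs : (-(Complex.I * (t : ℂ))) • H ∈ skewAdjoint (HalfLine →L[ℂ] HalfLine) := by
    rw [skewAdjoint.mem_iff, star_smul, hH.star_eq, ← neg_smul]
    congr 1
    simp
  let +nondep : NormedAlgebra ℚ (HalfLine →L[ℂ] HalfLine) := .restrictScalars ℚ ℂ _
  have hu := NormedSpace.exp_mem_unitary_of_mem_skewAdjoint hs
  exact ContinuousLinearMap.norm_map_of_mem_unitary hu ψ

theorem evolve_zero (H : HalfLine →L[ℂ] HalfLine) (ψ : HalfLine) : evolve H ψ 0 = ψ := by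
  simp [evolve]

/-- The Laplace transform `∫_0^∞ e^{(i E - ε) t} ψ(t) dt` of the time evolution. -/
noncomputable def evolveLaplace (H : HalfLine →L[ℂ] HalfLine) (ψ : HalfLine) (E ε : ℝ) :
    HalfLine :=
  ∫ t in Set.Ioi (0 : ℝ), Complex.exp ((Complex.I * E - ε) * t) • evolve H ψ t

theorem continuous_evolve (H : HalfLine →L[ℂ] HalfLine) (ψ : HalfLine) :
    Continuous (evolve H ψ) :=
  continuous_iff_continuousAt.2 fun t => (hasDerivAt_evolve H ψ t).continuousAt

theorem norm_exp_laplace (E ε t : ℝ) :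
    ‖Complex.exp ((Complex.I * E - ε) * t)‖ = Real.exp (-ε * t) := by
  rw [Complex.norm_exp]
  simp

theorem integrableOn_evolveLaplace {H : HalfLine →L[ℂ] HalfLine} (hH : IsSelfAdjoint H)
    (ψ : HalfLine) (E : ℝ) {ε : ℝ} (hε : 0 < ε) :
    IntegrableOn (fun t : ℝ => Complex.exp ((Complex.I * E - ε) * t) • evolve H ψ t)
      (Set.Ioi 0) := by
  have hi : IntegrableOn (fun t : ℝ => Real.exp (-ε * t) * ‖ψ‖) (Set.Ioi 0) :=
    (integrableOn_exp_mul_Ioi (by linarith) 0).mul_const _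
  refine Integrable.mono' hi ?_ (Eventually.of_forall fun t => ?_)
  · have := continuous_evolve H ψ
    exact Continuous.aestronglyMeasurable (by fun_prop)
  · rw [norm_smul, norm_exp_laplace, norm_evolve hH]

/-- Integrate the derivative of `e^{(iE-ε)t} ψ(t)` over the half-line: unitarity kills the boundary
term at infinity, and the one at `0` is the source. -/
theorem evolveLaplace_equation {H : HalfLine →L[ℂ] HalfLine} (hH : IsSelfAdjoint H)
    (ψ : HalfLine) (E : ℝ) {ε : ℝ} (hε : 0 < ε) :
    H (evolveLaplace H ψ E ε) - (E + Complex.I * ε) • evolveLaplace H ψ E ε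
      = -Complex.I • ψ := by
  set c : ℂ := Complex.I * E - ε with hc
  have hint := integrableOn_evolveLaplace hH ψ E hε
  have hd : ∀ t ∈ Set.Ici (0 : ℝ), HasDerivAt
      (fun t : ℝ => Complex.exp (c * t) • evolve H ψ t)
      (c • (Complex.exp (c * t) • evolve H ψ t)
        + -Complex.I • H (Complex.exp (c * t) • evolve H ψ t)) t := by
    intro t _
    have h1 : HasDerivAt (fun t : ℝ => Complex.exp (c * t)) (Complex.exp (c * t) * c) t := by
      have := ((hasDerivAt_id (t : ℂ)).const_mul c).cexp.comp_ofReal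
      simpa using this
    have h2 := h1.smul (hasDerivAt_evolve H ψ t)
    refine h2.congr_deriv ?_
    simp only [map_smul, smul_smul]
    rw [add_comm, mul_comm c (Complex.exp _), mul_comm (Complex.exp _) (-Complex.I)]
  have hH' : IntegrableOn (fun t : ℝ => H (Complex.exp (c * t) • evolve H ψ t)) (Set.Ioi 0) :=
    H.integrable_comp hint
  have htend : Tendsto (fun t : ℝ => Complex.exp (c * t) • evolve H ψ t) atTop (nhds 0) := by
    rw [tendsto_zero_iff_norm_tendsto_zero]
    have h1 : Tendsto (fun t : ℝ => Real.exp (-ε * t) * ‖ψ‖) atTop (nhds (0 * ‖ψ‖)) := by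
      refine Tendsto.mul_const _ (Real.tendsto_exp_atBot.comp ?_)
      exact tendsto_id.const_mul_atTop_of_neg (by linarith)
    rw [zero_mul] at h1
    refine h1.congr fun t => ?_
    rw [norm_smul, hc, norm_exp_laplace, norm_evolve hH]
  have hi1 : IntegrableOn (fun t : ℝ => c • (Complex.exp (c * t) • evolve H ψ t)) (Set.Ioi 0) :=
    hint.smul c
  have hi2 : IntegrableOn (fun t : ℝ => -Complex.I • H (Complex.exp (c * t) • evolve H ψ t))
      (Set.Ioi 0) := hH'.smul (-Complex.I)
  have key := integral_Ioi_of_hasDerivAt_of_tendsto' hd (hi1.add hi2) htend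
  rw [integral_add hi1 hi2, integral_smul, integral_smul,
    H.integral_comp_comm hint] at key
  simp only [Complex.ofReal_zero, mul_zero, Complex.exp_zero, one_smul, evolve_zero,
    zero_sub] at key
  change c • evolveLaplace H ψ E ε + -Complex.I • H (evolveLaplace H ψ E ε) = -ψ at key
  have := congrArg (fun x => Complex.I • x) key
  simp only [smul_add, smul_smul] at this
  have e1 : Complex.I * -Complex.I = 1 := by simp
  have e2 : Complex.I * c = -(E + Complex.I * ε) := by
    rw [hc, mul_sub, ← mul_assoc, Complex.I_mul_I]
    ring
  rw [e1, e2, one_smul, neg_smul, neg_add_eq_sub, smul_neg, ← neg_smul] at this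
  exact this

theorem evolveLaplace_coord {H : HalfLine →L[ℂ] HalfLine} (hH : IsSelfAdjoint H)
    (ψ : HalfLine) (E : ℝ) {ε : ℝ} (hε : 0 < ε) (n : ℕ+) :
    evolveLaplace H ψ E ε n = ∫ t in Set.Ioi (0 : ℝ),
      Complex.exp ((Complex.I * E - ε) * t) * inner ℂ (deltaState n) (evolve H ψ t) := by
  have h := (innerSL ℂ (deltaState n)).integral_comp_comm (integrableOn_evolveLaplace hH ψ E hε)
  simp only [innerSL_apply_apply, inner_smul_right] at h
  rw [h, inner_deltaState]
  rfl

/-! ### From the Laplace transform to averaged probabilities. -/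

/-- Cauchy–Schwarz for the finite measure `e^{-ε t} dt` on the half-line. -/
theorem sq_integral_exp_mul_le {g : ℝ → ℝ} {C ε : ℝ} (hε : 0 < ε) (hg : Continuous g)
    (hC : ∀ t, |g t| ≤ C) :
    ε * (∫ t in Set.Ioi (0 : ℝ), Real.exp (-ε * t) * g t) ^ 2
      ≤ ∫ t in Set.Ioi (0 : ℝ), Real.exp (-ε * t) * g t ^ 2 := by
  have h0 : IntegrableOn (fun t : ℝ => Real.exp (-ε * t)) (Set.Ioi 0) :=
    integrableOn_exp_mul_Ioi (by linarith) 0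
  have h1 : IntegrableOn (fun t : ℝ => Real.exp (-ε * t) * g t) (Set.Ioi 0) := by
    refine Integrable.mono' (h0.mul_const C) (Continuous.aestronglyMeasurable (by fun_prop))
      (Eventually.of_forall fun t => ?_)
    rw [norm_mul, Real.norm_of_nonneg (Real.exp_pos _).le]
    exact mul_le_mul_of_nonneg_left (hC t) (Real.exp_pos _).le
  have h2 : IntegrableOn (fun t : ℝ => Real.exp (-ε * t) * g t ^ 2) (Set.Ioi 0) := by
    refine Integrable.mono' (h0.mul_const (C ^ 2))
      (Continuous.aestronglyMeasurable (by fun_prop)) (Eventually.of_forall fun t => ?_)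
    rw [norm_mul, Real.norm_of_nonneg (Real.exp_pos _).le, norm_pow]
    exact mul_le_mul_of_nonneg_left (pow_le_pow_left₀ (abs_nonneg _) (hC t) 2)
      (Real.exp_pos _).le
  set B := ∫ t in Set.Ioi (0 : ℝ), Real.exp (-ε * t) * g t with hB
  have hI : ∫ t in Set.Ioi (0 : ℝ), Real.exp (-ε * t) = 1 / ε := by
    rw [integral_exp_mul_Ioi (by linarith)]
    simp
  -- The integrand is `e^{-εt} (g - εB)²`; `εB` is the mean of `g` for the probability measure `ε
  -- e^{-εt} dt`.
  have hnn : 0 ≤ ∫ t in Set.Ioi (0 : ℝ), (Real.exp (-ε * t) * g t ^ 2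
      - (2 * (ε * B)) * (Real.exp (-ε * t) * g t) + (ε * B) ^ 2 * Real.exp (-ε * t)) := by
    refine integral_nonneg fun t => ?_
    have : Real.exp (-ε * t) * g t ^ 2 - (2 * (ε * B)) * (Real.exp (-ε * t) * g t)
        + (ε * B) ^ 2 * Real.exp (-ε * t) = Real.exp (-ε * t) * (g t - ε * B) ^ 2 := by ring
    simp only [Pi.zero_apply]
    rw [this]
    positivity
  have h1' : IntegrableOn (fun t : ℝ => (2 * (ε * B)) * (Real.exp (-ε * t) * g t)) (Set.Ioi 0) :=
    h1.const_mul _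
  have h0' : IntegrableOn (fun t : ℝ => (ε * B) ^ 2 * Real.exp (-ε * t)) (Set.Ioi 0) :=
    h0.const_mul _
  have h21 : IntegrableOn (fun t : ℝ => Real.exp (-ε * t) * g t ^ 2
      - (2 * (ε * B)) * (Real.exp (-ε * t) * g t)) (Set.Ioi 0) := h2.sub h1'
  rw [integral_add h21 h0', integral_sub h2 h1', integral_const_mul, integral_const_mul, hI, ← hB] at hnn
  have : (ε * B) ^ 2 * (1 / ε) = ε * B ^ 2 := by field_simp
  nlinarith

theorem avgProb_nonneg (H : HalfLine →L[ℂ] HalfLine) (ψ : HalfLine) (n : ℕ+) {T : ℝ}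
    (hT : 0 < T) : 0 ≤ avgProb H ψ n T := by
  unfold avgProb
  exact mul_nonneg (by positivity) (integral_nonneg fun t => by positivity)

theorem le_avgProb {H : HalfLine →L[ℂ] HalfLine} (hH : IsSelfAdjoint H)
    (ψ : HalfLine) (E : ℝ) {T : ℝ} (hT : 0 < T) (n : ℕ+) :
    2 / T ^ 2 * ‖evolveLaplace H ψ E (2 / T) n‖ ^ 2 ≤ avgProb H ψ n T := by
  have hε : 0 < 2 / T := by positivity
  have hcs := sq_integral_exp_mul_le (C := ‖ψ‖) (ε := 2 / T)
    (g := fun t => ‖inner ℂ (deltaState n) (evolve H ψ t)‖) hε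
    (by have := continuous_evolve H ψ; fun_prop)
    (fun t => by
      rw [abs_norm]
      refine (norm_inner_le_norm _ _).trans ?_
      rw [norm_deltaState, norm_evolve hH, one_mul])
  have hle : ‖evolveLaplace H ψ E (2 / T) n‖ ≤ ∫ t in Set.Ioi (0 : ℝ),
      Real.exp (-(2 / T) * t) * ‖inner ℂ (deltaState n) (evolve H ψ t)‖ := by
    rw [evolveLaplace_coord hH ψ E hε]
    refine (norm_integral_le_integral_norm _).trans_eq ?_
    simp only [norm_mul, norm_exp_laplace]
  have hsq := pow_le_pow_left₀ (norm_nonneg _) hle 2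
  have he : avgProb H ψ n T = 1 / T * ∫ t in Set.Ioi (0 : ℝ),
      Real.exp (-(2 / T) * t) * ‖inner ℂ (deltaState n) (evolve H ψ t)‖ ^ 2 := by
    unfold avgProb
    congr 2
    funext t
    congr 2
    ring
  rw [he, show 2 / T ^ 2 = 1 / T * (2 / T) by ring, mul_assoc]
  refine mul_le_mul_of_nonneg_left (le_trans ?_ hcs) (by positivity)
  exact mul_le_mul_of_nonneg_left hsq hε.le

/-! ### Transfer matrices and the decay of solutions. -/

/-- The barrier step: the backward transfer matrix with rows `(z, -1)` and `(1, 0)` has squared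
Frobenius norm `|z|² + 2`. -/
theorem norm_mul_sub_sq_add_sq_le {d ε : ℝ} (hd : 0 ≤ d) (hε : 0 ≤ ε) {z : ℂ}
    (hz : ‖z‖ ≤ d + ε) (x y : ℂ) :
    ‖z * x - y‖ ^ 2 + ‖x‖ ^ 2 ≤ (1 + ε) ^ 2 * (2 + d ^ 2) * (‖x‖ ^ 2 + ‖y‖ ^ 2) := by
  have h : ‖z * x - y‖ ≤ (d + ε) * ‖x‖ + ‖y‖ := by
    refine (norm_sub_le _ _).trans ?_
    rw [norm_mul]
    gcongr
  have h2 := pow_le_pow_left₀ (norm_nonneg _) h 2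
  have h3 : ((d + ε) * ‖x‖ + ‖y‖) ^ 2 ≤ ((d + ε) ^ 2 + 1) * (‖x‖ ^ 2 + ‖y‖ ^ 2) := by
    nlinarith [sq_nonneg ((d + ε) * ‖y‖ - ‖x‖)]
  have h4 : (d + ε) ^ 2 + 2 ≤ (1 + ε) ^ 2 * (2 + d ^ 2) := by
    nlinarith [mul_nonneg hε (sq_nonneg (d - 1)), mul_nonneg (sq_nonneg ε) (sq_nonneg d),
      mul_nonneg hε hd, sq_nonneg ε]
  have h5 := mul_le_mul_of_nonneg_right h4 (add_nonneg (sq_nonneg ‖x‖) (sq_nonneg ‖y‖))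
  nlinarith [sq_nonneg ‖y‖]

/-- At `z = 0` the matrix is a rotation. The Frobenius bound would lose a factor of at least 2 at
every site, hence be exponentially bad in `n`. -/
theorem norm_mul_sub_sq_add_sq_le_of_free {ε : ℝ} (hε : 0 ≤ ε) {z : ℂ}
    (hz : ‖z‖ ≤ ε) (x y : ℂ) :
    ‖z * x - y‖ ^ 2 + ‖x‖ ^ 2 ≤ (1 + ε) ^ 2 * (‖x‖ ^ 2 + ‖y‖ ^ 2) := by
  have h : ‖z * x - y‖ ≤ ε * ‖x‖ + ‖y‖ := by
    refine (norm_sub_le _ _).trans ?_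
    rw [norm_mul]
    gcongr
  have h2 := pow_le_pow_left₀ (norm_nonneg _) h 2
  nlinarith [mul_nonneg hε (sq_nonneg (‖x‖ - ‖y‖)), mul_nonneg hε (sq_nonneg ‖x‖),
    mul_nonneg hε (sq_nonneg ‖y‖), mul_nonneg (sq_nonneg ε) (sq_nonneg ‖y‖)]

/-- A solution of the sparse eigenvalue equation at the complex energy `a + iε` cannot decay
faster than `(1 + ε)^{-n}` times the product of the barrier factors met up to the site `n`. -/
theorem sparse_solution_lower_bound {a b : ℝ} {γ : ℕ} (hγ : 2 ≤ γ) {ε : ℝ} (hε : 0 ≤ ε)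
    {u : ℕ → ℂ}
    (hu : ∀ n, u n = (a + Complex.I * ε - sparsePotential a b γ n.succPNat) * u (n + 1)
      - u (n + 2)) (n : ℕ) :
    ‖u 0‖ ^ 2 ≤ ((1 + ε) ^ 2) ^ n * (2 + (a - b) ^ 2) ^ Nat.log γ n
      * (‖u n‖ ^ 2 + ‖u (n + 1)‖ ^ 2) := by
  have hIε : ‖Complex.I * (ε : ℂ)‖ = ε := by simp [abs_of_nonneg hε]
  have hL : 1 ≤ 2 + (a - b) ^ 2 := by nlinarith [sq_nonneg (a - b)]
  induction n with
  | zero => simp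
  | succ n ih =>
    refine ih.trans ?_
    by_cases hk : ∃ k : ℕ, 1 ≤ k ∧ (n.succPNat : ℕ) = γ ^ k
    · have hz : ‖(a : ℂ) + Complex.I * ε - sparsePotential a b γ n.succPNat‖ ≤ |a - b| + ε := by
        have : (a : ℂ) + Complex.I * ε - sparsePotential a b γ n.succPNat
            = ((a - b : ℝ) : ℂ) + Complex.I * ε := by
          rw [sparsePotential, if_pos hk]
          push_cast
          ring
        rw [this]
        refine (norm_add_le _ _).trans ?_
        rw [hIε, Complex.norm_real, Real.norm_eq_abs]
      have h := norm_mul_sub_sq_add_sq_le (abs_nonneg _) hε hz (u (n + 1)) (u (n + 2))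
      rw [← hu n, sq_abs] at h
      obtain ⟨k, hk1, hk⟩ := hk
      simp only [Nat.succPNat_coe, Nat.succ_eq_add_one] at hk
      -- `Nat.log γ n` counts the barriers in `{1, …, n}`, so it jumps when `n + 1 = γ^k`.
      have hlog : Nat.log γ n + 1 ≤ Nat.log γ (n + 1) := by
        rw [hk, Nat.log_pow (by omega)]
        exact Nat.log_lt_of_lt_pow' (by omega) (by omega)
      calc _ ≤ ((1 + ε) ^ 2) ^ n * (2 + (a - b) ^ 2) ^ Nat.log γ n
            * ((1 + ε) ^ 2 * (2 + (a - b) ^ 2) * (‖u (n + 1)‖ ^ 2 + ‖u (n + 2)‖ ^ 2)) := by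
            gcongr
        _ = ((1 + ε) ^ 2) ^ (n + 1) * (2 + (a - b) ^ 2) ^ (Nat.log γ n + 1)
            * (‖u (n + 1)‖ ^ 2 + ‖u (n + 2)‖ ^ 2) := by ring
        _ ≤ _ := by gcongr
    · have hz : ‖(a : ℂ) + Complex.I * ε - sparsePotential a b γ n.succPNat‖ ≤ ε := by
        rw [sparsePotential, if_neg hk, add_sub_cancel_left, hIε]
      have h := norm_mul_sub_sq_add_sq_le_of_free hε hz (u (n + 1)) (u (n + 2))
      rw [← hu n] at h
      calc _ ≤ ((1 + ε) ^ 2) ^ n * (2 + (a - b) ^ 2) ^ Nat.log γ n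
            * ((1 + ε) ^ 2 * (‖u (n + 1)‖ ^ 2 + ‖u (n + 2)‖ ^ 2)) := by
            gcongr
        _ = ((1 + ε) ^ 2) ^ (n + 1) * (2 + (a - b) ^ 2) ^ Nat.log γ n
            * (‖u (n + 1)‖ ^ 2 + ‖u (n + 2)‖ ^ 2) := by ring
        _ ≤ _ := by
            gcongr
            omega

/-! ### The exponent `ν` and the pointwise lower bound. -/

theorem sparseNu_eq (a b : ℝ) (γ : ℕ) :
    sparseNu a b γ = Real.log (2 + (a - b) ^ 2) / Real.log γ := by
  rw [sparseNu, Real.log_sqrt (by positivity)]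
  ring

theorem sparseNu_pos (a b : ℝ) {γ : ℕ} (hγ : 2 ≤ γ) : 0 < sparseNu a b γ := by
  rw [sparseNu_eq]
  have : (2 : ℝ) ≤ γ := by exact_mod_cast hγ
  exact div_pos (Real.log_pos (by nlinarith [sq_nonneg (a - b)])) (Real.log_pos (by linarith))

theorem rpow_sparseNu (a b : ℝ) {γ : ℕ} (hγ : 2 ≤ γ) :
    (γ : ℝ) ^ sparseNu a b γ = 2 + (a - b) ^ 2 := by
  have : (2 : ℝ) ≤ γ := by exact_mod_cast hγ
  have hl : Real.log γ ≠ 0 := (Real.log_pos (by linarith)).ne'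
  rw [Real.rpow_def_of_pos (by linarith), sparseNu_eq, mul_div_cancel₀ _ hl,
    Real.exp_log (by positivity)]

theorem barrier_factor_le (a b : ℝ) {γ : ℕ} (hγ : 2 ≤ γ) {n : ℕ} (hn : n ≠ 0) :
    (2 + (a - b) ^ 2) ^ Nat.log γ n ≤ (n : ℝ) ^ sparseNu a b γ := by
  rw [← rpow_sparseNu a b hγ, ← Real.rpow_natCast, ← Real.rpow_mul (by positivity), mul_comm,
    Real.rpow_mul (by positivity), Real.rpow_natCast]
  refine Real.rpow_le_rpow (by positivity) ?_ (sparseNu_pos a b hγ).le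
  exact_mod_cast Nat.pow_log_le_self γ hn

theorem le_avgProb_add_avgProb_succ {a b : ℝ} {γ : ℕ} (hγ : 2 ≤ γ) {T : ℝ} (hT : 0 < T)
    {n : ℕ+} (hn : (n : ℝ) ≤ 2 * T) :
    2 / T ^ 2 * (Real.exp (-8) * (n : ℝ) ^ (-sparseNu a b γ))
      ≤ avgProb (sparseOp a b γ) (deltaState 1) n T
        + avgProb (sparseOp a b γ) (deltaState 1) (n + 1) T := by
  have hε : 0 < 2 / T := by positivity
  have hH : IsSelfAdjoint (sparseOp a b γ) := isSelfAdjoint_schrodingerOp _ _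
  set W := evolveLaplace (sparseOp a b γ) (deltaState 1) a (2 / T) with hW
  have hWeq := evolveLaplace_equation hH (deltaState 1) a hε
  rw [← hW] at hWeq
  -- Replacing the Dirichlet value at `0` by `i` absorbs the source `-i δ₁`, so `u` solves the
  -- homogeneous recursion and has known size at `0`.
  let u : ℕ → ℂ := fun k => if k = 0 then Complex.I else dirichletExt W k
  have hu : ∀ k, u k = (a + Complex.I * (2 / T : ℝ)
      - sparsePotential a b γ k.succPNat) * u (k + 1) - u (k + 2) := by
    intro k
    have h := congrArg (fun x : HalfLine => x k.succPNat) hWeq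
    simp only [lp.coeFn_sub, lp.coeFn_smul, Pi.sub_apply, Pi.smul_apply, smul_eq_mul,
      sparseOp, schrodingerOp_apply, Nat.succPNat_coe, Nat.succ_eq_add_one,
      Nat.add_sub_cancel] at h
    have hk : W k.succPNat = u (k + 1) := by
      simpa [u] using (dirichletExt_coe W k.succPNat).symm
    have hk2 : dirichletExt W (k + 1 + 1) = u (k + 2) := by simp [u]
    rw [hk, hk2] at h
    rcases Nat.eq_zero_or_pos k with rfl | hpos
    · have h1 : (deltaState 1 : HalfLine) (Nat.succPNat 0) = 1 := by
        have : Nat.succPNat 0 = 1 := rfl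
        rw [this]
        simp [deltaState]
      have h0 : dirichletExt W 0 = 0 := by simp [dirichletExt]
      rw [h1, h0] at h
      have : u 0 = Complex.I := by simp [u]
      rw [this]
      linear_combination h
    · have h1 : (deltaState 1 : HalfLine) k.succPNat = 0 := by
        have : k.succPNat ≠ 1 := fun h => by
          have := congrArg PNat.val h
          simp at this
          omega
        simp [deltaState, lp.single_apply, this]
      have h0 : dirichletExt W k = u k := by simp [u, hpos.ne']
      rw [h1, h0] at h
      linear_combination h
  have hlow := sparse_solution_lower_bound hγ hε.le hu n
  have hu0 : ‖u 0‖ ^ 2 = 1 := by simp [u]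
  have hun : u n = W n := by simpa [u] using dirichletExt_coe W n
  have hun1 : u (n + 1) = W (n + 1) := by simpa [u] using dirichletExt_coe W (n + 1)
  rw [hu0, hun, hun1] at hlow
  -- `(1 + 2/T)^{2n} ≤ e^{4n/T}`, and `n ≤ 2T`.
  have hexp : ((1 + 2 / T) ^ 2) ^ (n : ℕ) ≤ Real.exp 8 := by
    rw [← pow_mul]
    refine (pow_le_pow_left₀ (by positivity)
      ((add_comm _ _).trans_le (Real.add_one_le_exp (2 / T))) _).trans ?_
    rw [← Real.exp_nat_mul, Real.exp_le_exp]
    push_cast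
    rw [mul_div_assoc', div_le_iff₀ hT]
    linarith
  have hbar := barrier_factor_le a b hγ n.ne_zero
  have hnpos : (0 : ℝ) < n := by exact_mod_cast n.pos
  have hfinal : Real.exp (-8) * (n : ℝ) ^ (-sparseNu a b γ)
      ≤ ‖W n‖ ^ 2 + ‖W (n + 1)‖ ^ 2 := by
    rw [Real.exp_neg, Real.rpow_neg hnpos.le, ← mul_inv, inv_le_iff_one_le_mul₀' (by positivity)]
    refine hlow.trans ?_
    gcongr
  have hp1 := le_avgProb hH (deltaState 1) a hT n
  have hp2 := le_avgProb hH (deltaState 1) a hT (n + 1)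
  have := mul_le_mul_of_nonneg_left hfinal (show 0 ≤ 2 / T ^ 2 by positivity)
  rw [← hW] at hp1 hp2
  linarith

/-! ### Summing over a window; the growth exponent. -/

/-- Transfer matrices control only pairs of neighbouring sites; each site lies in at most two pairs.
-/
theorem mul_le_two_mul_sum_of_le_add_succ {A : ℕ → ℝ} {c : ℝ} (M : ℕ) (hA : ∀ k, 0 ≤ A k)
    (h : ∀ k < M, c ≤ A k + A (k + 1)) :
    M * c ≤ 2 * ∑ k ∈ Finset.range (M + 1), A k := by
  have h1 : ∑ _k ∈ Finset.range M, c ≤ ∑ k ∈ Finset.range M, (A k + A (k + 1)) :=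
    Finset.sum_le_sum fun k hk => h k (Finset.mem_range.1 hk)
  rw [Finset.sum_const, Finset.card_range, nsmul_eq_mul, Finset.sum_add_distrib] at h1
  have h2 := Finset.sum_range_succ A M
  have h3 := Finset.sum_range_succ' A M
  linarith [hA 0, hA M]

theorem le_avgMoment_of_le_add_succ {H : HalfLine →L[ℂ] HalfLine} {ψ : HalfLine} {p T c : ℝ}
    (hp : 0 ≤ p) (hT : 0 < T) {M : ℕ} (hM : 1 ≤ M)
    (h : ∀ n : ℕ+, M ≤ n → (n : ℕ) < 2 * M → c ≤ avgProb H ψ n T + avgProb H ψ (n + 1) T) :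
    ENNReal.ofReal ((M : ℝ) ^ p * (M * c / 2)) ≤ avgMoment H ψ p T := by
  let site : ℕ → ℕ+ := fun k => ⟨M + k, by omega⟩
  have hinj : Function.Injective site := fun k l hkl => by
    have := congrArg PNat.val hkl
    simpa [site] using this
  have h1 := mul_le_two_mul_sum_of_le_add_succ (A := fun k => avgProb H ψ (site k) T) (c := c) M
    (fun k => avgProb_nonneg H ψ _ hT) (fun k hk =>
      h (site k) (by simp [site]) (by simp [site]; omega))
  have h2 : (M : ℝ) ^ p * (M * c / 2) ≤
      ∑ k ∈ Finset.range (M + 1), ((site k : ℕ) : ℝ) ^ p * avgProb H ψ (site k) T := by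
    have h3 : (M : ℝ) ^ p * ∑ k ∈ Finset.range (M + 1), avgProb H ψ (site k) T ≤
        ∑ k ∈ Finset.range (M + 1), ((site k : ℕ) : ℝ) ^ p * avgProb H ψ (site k) T := by
      rw [Finset.mul_sum]
      refine Finset.sum_le_sum fun k _ => mul_le_mul_of_nonneg_right ?_ (avgProb_nonneg H ψ _ hT)
      refine Real.rpow_le_rpow (by positivity) ?_ hp
      simp [site]
    refine le_trans (mul_le_mul_of_nonneg_left ?_ (by positivity)) h3
    linarith
  calc ENNReal.ofReal ((M : ℝ) ^ p * (M * c / 2))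
      ≤ ENNReal.ofReal
        (∑ k ∈ Finset.range (M + 1), ((site k : ℕ) : ℝ) ^ p * avgProb H ψ (site k) T) :=
        ENNReal.ofReal_le_ofReal h2
    _ = ∑ k ∈ Finset.range (M + 1),
        ENNReal.ofReal (((site k : ℕ) : ℝ) ^ p * avgProb H ψ (site k) T) :=
        ENNReal.ofReal_sum_of_nonneg fun k _ =>
          mul_nonneg (by positivity) (avgProb_nonneg H ψ _ hT)
    _ ≤ ∑' k, ENNReal.ofReal (((site k : ℕ) : ℝ) ^ p * avgProb H ψ (site k) T) :=
        ENNReal.sum_le_tsum _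
    _ ≤ avgMoment H ψ p T := ENNReal.tsum_comp_le_tsum_of_injective hinj _

theorem le_liminf_log_div_log {F : ℝ → ℝ≥0∞} {K q : ℝ} (hK : 0 < K)
    (hF : ∀ T, 1 ≤ T → ENNReal.ofReal (K * T ^ q) ≤ F T) :
    (q : EReal) ≤ liminf (fun T : ℝ => ENNReal.log (F T) / ((Real.log T : ℝ) : EReal)) atTop := by
  have hlim : Tendsto (fun T : ℝ => (Real.log K + q * Real.log T) / Real.log T) atTop (nhds q) := by
    have h0 : Tendsto (fun T : ℝ => Real.log K / Real.log T + q) atTop (nhds (0 + q)) :=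
      (Real.tendsto_log_atTop.const_div_atTop _).add_const q
    rw [zero_add] at h0
    refine h0.congr' ?_
    filter_upwards [eventually_gt_atTop 1] with T hT
    have := (Real.log_pos hT).ne'
    field_simp
  have hlim' : Tendsto (fun T : ℝ =>
      (((Real.log K + q * Real.log T) / Real.log T : ℝ) : EReal)) atTop (nhds (q : EReal)) :=
    (continuous_coe_real_ereal.tendsto q).comp hlim
  rw [← hlim'.liminf_eq]
  refine liminf_le_liminf ?_
  filter_upwards [eventually_gt_atTop 1] with T hT
  have hT0 : 0 < T := by linarith
  rw [EReal.coe_div]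
  refine EReal.div_le_div_right_of_nonneg (by exact_mod_cast (Real.log_pos hT).le) ?_
  refine le_trans ?_ (ENNReal.log_le_log (hF T hT.le))
  rw [ENNReal.log_ofReal_of_pos (by positivity), Real.log_mul hK.ne' (by positivity),
    Real.log_rpow hT0]

theorem sparse_avgMoment_lower_bound (a b : ℝ) {γ : ℕ} (hγ : 2 ≤ γ) {p T : ℝ} (hp : 0 < p)
    (hT : 1 ≤ T) :
    ENNReal.ofReal ((2 : ℝ) ^ (-(p + 1)) * 2 ^ (-sparseNu a b γ) * Real.exp (-8)
      * T ^ ((p - 1 - 4 * sparseNu a b γ) / (1 + sparseNu a b γ)))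
      ≤ avgMoment (sparseOp a b γ) (deltaState 1) p T := by
  set ν := sparseNu a b γ with hν
  have hν0 : 0 < ν := sparseNu_pos a b hγ
  have hT0 : 0 < T := by linarith
  -- This scale serves every `p > 0`. At scale `T` the count would give the exponent `p - 1 - ν`,
  -- which is below the claim once `ν > p + 2`.
  set s := T ^ (1 / (1 + ν)) with hs
  have hs1 : 1 ≤ s := Real.one_le_rpow hT (by positivity)
  have hsT : s ≤ T := by
    conv_rhs => rw [← Real.rpow_one T]
    refine Real.rpow_le_rpow_of_exponent_le hT ?_
    rw [div_le_one (by positivity)]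
    linarith
  set M := ⌊s⌋₊ with hM
  have hM1 : 1 ≤ M := Nat.le_floor (by simpa using hs1)
  have hMs : (M : ℝ) ≤ s := Nat.floor_le (by linarith)
  have hM1' : (1 : ℝ) ≤ M := by exact_mod_cast hM1
  have hM2 : s / 2 ≤ M := by
    have := Nat.lt_floor_add_one s
    rw [← hM] at this
    linarith
  have hmain := le_avgMoment_of_le_add_succ (H := sparseOp a b γ) (ψ := deltaState 1)
    (c := 2 / T ^ 2 * (Real.exp (-8) * (2 * s) ^ (-ν))) hp.le hT0 hM1 (by
      intro n _ hn
      have hn' : (n : ℝ) ≤ 2 * M := by exact_mod_cast hn.le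
      refine le_trans ?_ (le_avgProb_add_avgProb_succ hγ hT0 (by linarith))
      have hnpos : (0 : ℝ) < n := by exact_mod_cast n.pos
      have := Real.rpow_le_rpow_of_nonpos hnpos (show (n : ℝ) ≤ 2 * s by linarith)
        (show -ν ≤ 0 by linarith)
      gcongr)
  refine le_trans (ENNReal.ofReal_le_ofReal ?_) hmain
  have e1 : (M : ℝ) ^ p * (M * (2 / T ^ 2 * (Real.exp (-8) * (2 * s) ^ (-ν))) / 2)
      = (M : ℝ) ^ (p + 1) * (2 ^ (-ν) * s ^ (-ν) * Real.exp (-8) / T ^ 2) := by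
    rw [Real.rpow_add_one (by linarith), Real.mul_rpow (by norm_num) (by linarith)]
    ring
  have e2 : (2 : ℝ) ^ (-(p + 1)) * s ^ (p + 1) ≤ (M : ℝ) ^ (p + 1) := by
    have := Real.rpow_le_rpow (by positivity) hM2 (show 0 ≤ p + 1 by linarith)
    rwa [Real.div_rpow (by linarith) (by norm_num), div_eq_mul_inv,
      ← Real.rpow_neg (by norm_num), mul_comm] at this
  -- The right side has exponent `(p - 1 - 3ν)/(1 + ν)`, so there is room to spare.
  have e3 : T ^ ((p - 1 - 4 * ν) / (1 + ν)) ≤ s ^ (p + 1) * s ^ (-ν) / T ^ 2 := by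
    rw [← Real.rpow_add (by linarith), hs, ← Real.rpow_mul hT0.le, ← Real.rpow_natCast T 2,
      ← Real.rpow_sub hT0]
    refine Real.rpow_le_rpow_of_exponent_le hT ?_
    rw [div_le_iff₀ (by positivity)]
    have : (1 / (1 + ν) * (p + 1 + -ν) - ((2 : ℕ) : ℝ)) * (1 + ν) = p - 1 - 3 * ν := by
      field_simp
      push_cast
      ring
    rw [this]
    linarith
  rw [e1]
  calc _ ≤ (2 : ℝ) ^ (-(p + 1)) * 2 ^ (-ν) * Real.exp (-8)
        * (s ^ (p + 1) * s ^ (-ν) / T ^ 2) := by gcongr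
    _ = ((2 : ℝ) ^ (-(p + 1)) * s ^ (p + 1)) * (2 ^ (-ν) * s ^ (-ν) * Real.exp (-8) / T ^ 2) := by
        ring
    _ ≤ _ := by gcongr

theorem proposition4p9 (a b : ℝ) (γ : ℕ) (hγ : 2 ≤ γ) :
    (∀ p : ℝ, 0 < p →
      (((p - 1 - 4 * sparseNu a b γ) / (1 + sparseNu a b γ) : ℝ) : EReal)
        ≤ lowerGrowthExponent (sparseOp a b γ) (deltaState 1) p) ∧
    (∀ p : ℝ, 0 < p →
      ((p - 5) / 2 < (p - 1 - 4 * sparseNu a b γ) / (1 + sparseNu a b γ) ↔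
        2 + (a - b) ^ 2 < (γ : ℝ))) := by
  constructor
  · intro p hp
    exact le_liminf_log_div_log (by positivity)
      fun T hT => sparse_avgMoment_lower_bound a b hγ hp hT
  · intro p hp
    have hν := sparseNu_pos a b hγ
    have hγ' : (2 : ℝ) ≤ γ := by exact_mod_cast hγ
    have h1 : (p - 5) / 2 < (p - 1 - 4 * sparseNu a b γ) / (1 + sparseNu a b γ) ↔
        sparseNu a b γ < 1 := by
      rw [div_lt_div_iff₀ (by norm_num) (by linarith)]
      -- After clearing denominators the difference of the two sides is `(p + 3)(1 - ν)`.
      constructor <;> intro h <;> nlinarith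
    rw [h1, sparseNu_eq, div_lt_one (Real.log_pos (by linarith)),
      Real.log_lt_log_iff (by positivity) (by linarith)]
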